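/- An $n\times n$ complex matrix $T$ is Toeplitz if $T_{i,j}=T_{i+1,j+1}$ for all $1\le i,j\le n-1$. For $M\in\mathbb{C}^{n\times n}$ let $\mathrm{Toep}(M)$ be the least $s\ge 1$ such that $M=T_1T_2\cdots T_s$ for some Toeplitz matrices $T_1,\dots,T_s\in\mathbb{C}^{n\times n}$ ($\infty$ if there is no such $s$), and let $\mathrm{Toep}_n$ be the maximum of $\mathrm{Toep}(M)$ over all $M\in\mathbb{C}^{n\times n}$. Then \[3\le \mathrm{Toep}_3\le 4 .\] Moreover, $\mathrm{Toep}(\operatorname{diag}(1,2,3))=3$, and for every $M\in\mathbb{C}^{3\times 3}$: if $\operatorname{rank} M=1$ then $\mathrm{Toep}(M)\le 3$; if $\operatorname{rank} M=2$ then $\mathrm{Toep}(M)\le 4$; if $M$ is invertible then $\mathrm{Toep}(M)\le 4$. -/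

import Mathlib

/-- A square matrix is Toeplitz if it is constant along each diagonal:
`M i j = M (i+1) (j+1)` whenever all four indices are in range. -/
def IsToeplitz {n : ℕ} (M : Matrix (Fin n) (Fin n) ℂ) : Prop :=
  ∀ i j i' j' : Fin n, i'.val = i.val + 1 → j'.val = j.val + 1 → M i j = M i' j'

/-- `M` has a Toeplitz decomposition `M = T₁ ⋯ Tₛ` of length `s`. -/
def HasToeplitzDecomposition {n : ℕ} (M : Matrix (Fin n) (Fin n) ℂ) (s : ℕ) : Prop :=
  ∃ T : Fin s → Matrix (Fin n) (Fin n) ℂ,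
    (∀ k, IsToeplitz (T k)) ∧ M = (List.ofFn T).prod

/-- The Toeplitz number of `M`: the minimal length `s ≥ 1` of a Toeplitz decomposition of `M`
(it is `⊤` if there is none). -/
noncomputable def toeplitzNumber {n : ℕ} (M : Matrix (Fin n) (Fin n) ℂ) : ℕ∞ :=
  ⨅ (s : ℕ) (_ : 1 ≤ s ∧ HasToeplitzDecomposition M s), (s : ℕ∞)

/-- The maximal Toeplitz number of order `n`: the maximum of `toeplitzNumber M` over all
complex `n × n` matrices. In `ℕ∞` a finite supremum of a nonempty family is attained,
so whenever this value is finite it is a maximum. -/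
noncomputable def maxToeplitzNumber (n : ℕ) : ℕ∞ :=
  ⨆ M : Matrix (Fin n) (Fin n) ℂ, toeplitzNumber M

/-!
Lower bound: a Toeplitz matrix is fixed by `T ↦ J Tᵀ J`, where `J` reverses the order of the basis.
So if `D = S T` with `S`, `T` Toeplitz then `T S = J Dᵀ J` and `S (J Dᵀ J) = D S`; for diagonal `D`
with distinct entries this confines `S` to its antidiagonal.

Invertible `M`: choose `α` such that `x = row 1 + α • row 0` has a nonsingular `2 × 2` Toeplitz
minor. For every `a` and `e`, dividing `M` on the left by `toep a (-(a * α)) 1 (-α) e` puts a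
multiple of `x` in row `1`, and the free parameters are used to make the other rows of the quotient
complete it to a product of three Toeplitz matrices.

Singular `M`: multiplying on the left by an invertible `f`-circulant matrix, whose inverse is again
Toeplitz, makes row `1` vanish, and a matrix with vanishing row `1` is a product of three.
-/

open Matrix

namespace IsToeplitz

variable {n : ℕ} {S T : Matrix (Fin n) (Fin n) ℂ}

theorem one : IsToeplitz (1 : Matrix (Fin n) (Fin n) ℂ) := by
  intro i j i' j' hi hj
  have h : i = j ↔ i' = j' := by omega
  simp only [one_apply, h]

theorem smul (hT : IsToeplitz T) (c : ℂ) : IsToeplitz (c • T) := fun i j i' j' hi hj => by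
  rw [Matrix.smul_apply, Matrix.smul_apply, hT i j i' j' hi hj]

theorem transpose (hT : IsToeplitz T) : IsToeplitz Tᵀ :=
  fun _ _ _ _ hi hj => hT _ _ _ _ hj hi

theorem apply_eq_of_val_eq_add (hT : IsToeplitz T) {i j i' j' : Fin n} (k : ℕ)
    (hi : i'.val = i.val + k) (hj : j'.val = j.val + k) : T i j = T i' j' := by
  induction k generalizing i' j' with
  | zero => rw [Fin.ext hi, Fin.ext hj]
  | succ k ih =>
    have hi' : i.val + k < n := by omega
    have hj' : j.val + k < n := by omega
    exact (ih (i' := ⟨_, hi'⟩) (j' := ⟨_, hj'⟩) rfl rfl).trans (hT _ _ _ _ hi hj)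

theorem apply_eq_apply (hT : IsToeplitz T) {i j i' j' : Fin n}
    (h : i.val + j'.val = i'.val + j.val) : T i j = T i' j' := by
  rcases le_total i.val i'.val with hle | hle
  · exact hT.apply_eq_of_val_eq_add (i'.val - i.val) (by omega) (by omega)
  · exact (hT.apply_eq_of_val_eq_add (i.val - i'.val) (by omega) (by omega)).symm

theorem transpose_submatrix_rev (hT : IsToeplitz T) :
    Tᵀ.submatrix Fin.revPerm Fin.revPerm = T := by
  ext i j
  refine hT.apply_eq_apply ?_
  simp only [Fin.revPerm_apply, Fin.val_rev]
  omega

theorem mul_eq_transpose_mul_submatrix_rev (hS : IsToeplitz S) (hT : IsToeplitz T) :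
    T * S = (S * T)ᵀ.submatrix Fin.revPerm Fin.revPerm := by
  rw [transpose_mul, ← submatrix_mul_equiv _ _ _ Fin.revPerm, hS.transpose_submatrix_rev,
    hT.transpose_submatrix_rev]

theorem mul_diagonal_rev_eq_diagonal_mul {d : Fin n → ℂ} (hS : IsToeplitz S) (hT : IsToeplitz T)
    (h : diagonal d = S * T) :
    S * diagonal (d ∘ Fin.rev) = diagonal d * S := by
  have hTS : T * S = diagonal (d ∘ Fin.rev) := by
    rw [hS.mul_eq_transpose_mul_submatrix_rev hT, ← h, diagonal_transpose, submatrix_diagonal_equiv]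
    rfl
  rw [← hTS, h, Matrix.mul_assoc]

theorem apply_eq_zero_of_diagonal_eq_mul {d : Fin n → ℂ} (hd : Function.Injective d)
    (hS : IsToeplitz S) (hT : IsToeplitz T) (h : diagonal d = S * T) {i j : Fin n}
    (hij : j ≠ i.rev) : S i j = 0 := by
  have hcomm := congrFun₂ (hS.mul_diagonal_rev_eq_diagonal_mul hT h) i j
  rw [mul_diagonal, diagonal_mul, mul_comm, Function.comp_apply] at hcomm
  refine (mul_eq_mul_right_iff.1 hcomm).resolve_left fun hdij => hij ?_
  rw [← hd hdij, Fin.rev_rev]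

end IsToeplitz

/-- An interior row of the left factor vanishes: off the antidiagonal because `d` is injective, and
on it because the next entry along the diagonal is off the antidiagonal. -/
theorem diagonal_ne_mul_of_isToeplitz {n : ℕ} {d : Fin n → ℂ} (hd : Function.Injective d)
    {i : Fin n} (hi₀ : 0 < i.val) (hi : i.val + 1 < n) (hdi : d i ≠ 0)
    {S T : Matrix (Fin n) (Fin n) ℂ} (hS : IsToeplitz S) (hT : IsToeplitz T) :
    diagonal d ≠ S * T := by
  intro h
  have hrow : ∀ j, S i j = 0 := fun j => by
    by_cases hj : j = i.rev
    · have hj' : j.val + 1 < n := by rw [hj, Fin.val_rev]; omega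
      rw [hS i j ⟨_, hi⟩ ⟨_, hj'⟩ rfl rfl]
      refine IsToeplitz.apply_eq_zero_of_diagonal_eq_mul hd hS hT h fun h' => ?_
      simp only [Fin.ext_iff, Fin.val_rev, hj] at h'
      omega
    · exact IsToeplitz.apply_eq_zero_of_diagonal_eq_mul hd hS hT h hj
  have hii := congrFun₂ h i i
  rw [diagonal_apply_eq, mul_apply] at hii
  exact hdi (hii.trans (Finset.sum_eq_zero fun j _ => by rw [hrow, zero_mul]))

section Decomposition

variable {n s : ℕ} {M N T : Matrix (Fin n) (Fin n) ℂ}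

theorem hasToeplitzDecomposition_zero_iff : HasToeplitzDecomposition M 0 ↔ M = 1 := by
  simp [HasToeplitzDecomposition]

theorem hasToeplitzDecomposition_succ_iff :
    HasToeplitzDecomposition M (s + 1) ↔
      ∃ T N, IsToeplitz T ∧ HasToeplitzDecomposition N s ∧ M = T * N := by
  constructor
  · rintro ⟨T, hT, rfl⟩
    exact ⟨T 0, _, hT 0, ⟨fun k => T k.succ, fun k => hT k.succ, rfl⟩, by
      rw [List.ofFn_succ, List.prod_cons]⟩
  · rintro ⟨T, _, hT, ⟨U, hU, rfl⟩, rfl⟩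
    refine ⟨Fin.cons T U, Fin.cases hT hU, ?_⟩
    simp only [List.ofFn_succ, Fin.cons_zero, Fin.cons_succ, List.prod_cons]

theorem hasToeplitzDecomposition_one_iff : HasToeplitzDecomposition M 1 ↔ IsToeplitz M := by
  simp [hasToeplitzDecomposition_succ_iff (s := 0), hasToeplitzDecomposition_zero_iff]

theorem HasToeplitzDecomposition.mul_left (hN : HasToeplitzDecomposition N s)
    (hT : IsToeplitz T) : HasToeplitzDecomposition (T * N) (s + 1) :=
  hasToeplitzDecomposition_succ_iff.2 ⟨T, N, hT, hN, rfl⟩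

theorem HasToeplitzDecomposition.mono (hM : HasToeplitzDecomposition M s) {t : ℕ} (hst : s ≤ t) :
    HasToeplitzDecomposition M t := by
  induction hst with
  | refl => exact hM
  | step _ ih => simpa only [one_mul] using ih.mul_left IsToeplitz.one

theorem IsToeplitz.hasToeplitzDecomposition_mul_mul {A B C : Matrix (Fin n) (Fin n) ℂ}
    (hA : IsToeplitz A) (hB : IsToeplitz B) (hC : IsToeplitz C) :
    HasToeplitzDecomposition (A * B * C) 3 :=
  Matrix.mul_assoc A B C ▸ ((hasToeplitzDecomposition_one_iff.2 hC).mul_left hB).mul_left hA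

theorem toeplitzNumber_le_iff (hs : 1 ≤ s) :
    toeplitzNumber M ≤ s ↔ HasToeplitzDecomposition M s := by
  refine ⟨fun h => ?_, fun h => iInf₂_le s ⟨hs, h⟩⟩
  by_contra hM
  have hlt : ((s + 1 : ℕ) : ℕ∞) ≤ toeplitzNumber M := le_iInf₂ fun t ht =>
    Nat.cast_le.2 (Nat.lt_of_not_le fun hts => hM (ht.2.mono hts))
  exact absurd (Nat.cast_le.1 (hlt.trans h)) s.not_succ_le_self

end Decomposition

theorem three_le_toeplitzNumber_diagonal {n : ℕ} {d : Fin n → ℂ} (hd : Function.Injective d)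
    {i : Fin n} (hi₀ : 0 < i.val) (hi : i.val + 1 < n) (hdi : d i ≠ 0) :
    3 ≤ toeplitzNumber (diagonal d) := by
  suffices h : ¬ toeplitzNumber (diagonal d) ≤ (2 : ℕ) from Order.add_one_le_of_lt (not_le.1 h)
  intro h
  obtain ⟨S, T, hS, hT, hST⟩ :=
    hasToeplitzDecomposition_succ_iff.1 ((toeplitzNumber_le_iff one_le_two).1 h)
  exact diagonal_ne_mul_of_isToeplitz hd hi₀ hi hdi hS (hasToeplitzDecomposition_one_iff.1 hT) hST

/-- The `3 × 3` Toeplitz matrix whose diagonals, from the upper right to the lower left corner,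
carry `a, b, c, d, e`. -/
def toep {R : Type*} (a b c d e : R) : Matrix (Fin 3) (Fin 3) R := !![c, b, a; d, c, b; e, d, c]

theorem isToeplitz_toep (a b c d e : ℂ) : IsToeplitz (toep a b c d e) := by
  intro i j i' j' hi hj
  fin_cases i <;> fin_cases j <;> fin_cases i' <;> fin_cases j' <;> simp_all [toep]

theorem toeplitzNumber_diagonal_le_three : toeplitzNumber (diagonal ![(1 : ℂ), 2, 3]) ≤ 3 := by
  have h : diagonal ![(1 : ℂ), 2, 3] =
      toep 0 0 1 0 2 * toep (-1) 0 (-1) 0 (1 / 2) * toep 2 0 (-2) 0 1 := by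
    ext i j
    fin_cases i <;> fin_cases j <;> simp [toep, mul_apply, Fin.sum_univ_three] <;> norm_num
  refine (toeplitzNumber_le_iff (s := 3) (by norm_num)).2 (h ▸ ?_)
  exact (isToeplitz_toep _ _ _ _ _).hasToeplitzDecomposition_mul_mul (isToeplitz_toep _ _ _ _ _)
    (isToeplitz_toep _ _ _ _ _)

theorem exists_eq_vecMulVec_of_rank_eq_one {m n K : Type*} [Fintype n] [Field K]
    {M : Matrix m n K} (hM : M.rank = 1) : ∃ x y, M = vecMulVec x y := by
  classical
  obtain ⟨x, -, hx⟩ := finrank_eq_one_iff'.1 hM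
  choose y hy using fun j => hx ⟨M *ᵥ Pi.single j 1, Pi.single j 1, rfl⟩
  refine ⟨x, y, ?_⟩
  ext i j
  have hij := congrFun (congrArg Subtype.val (hy j)) i
  simpa [vecMulVec_apply, mul_comm] using hij.symm

/-- The middle factor is the all-ones matrix; the outer ones have row sums `x` and column sums
`y`. -/
theorem vecMulVec_eq_toep_mul_toep_mul_toep {R : Type*} [CommRing R] (x y : Fin 3 → R) :
    vecMulVec x y = toep (x 0 - x 1) 0 (x 1) 0 (x 2 - x 1) * toep 1 1 1 1 1 *
      toep (y 2 - y 1) 0 (y 1) 0 (y 0 - y 1) := by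
  ext i j
  fin_cases i <;> fin_cases j <;>
    simp [toep, vecMulVec_apply, mul_apply, Fin.sum_univ_three] <;> ring

theorem toeplitzNumber_le_three_of_rank_eq_one {M : Matrix (Fin 3) (Fin 3) ℂ} (hM : M.rank = 1) :
    toeplitzNumber M ≤ 3 := by
  obtain ⟨x, y, rfl⟩ := exists_eq_vecMulVec_of_rank_eq_one hM
  refine (toeplitzNumber_le_iff (s := 3) (by norm_num)).2 ?_
  rw [vecMulVec_eq_toep_mul_toep_mul_toep]
  exact (isToeplitz_toep _ _ _ _ _).hasToeplitzDecomposition_mul_mul (isToeplitz_toep _ _ _ _ _)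
    (isToeplitz_toep _ _ _ _ _)

theorem exists_ne_zero_add_mul_add_mul_sq_ne_zero {R : Type*} [CommRing R] [IsDomain R]
    [Infinite R] {a b c : R} (h : ¬ (a = 0 ∧ b = 0 ∧ c = 0)) :
    ∃ x ≠ 0, a + b * x + c * x ^ 2 ≠ 0 := by
  open Polynomial in
  by_contra! hroots
  have hzero : X * (C a + C b * X + C c * X ^ 2) = (0 : R[X]) := Polynomial.funext fun x => by
    by_cases hx : x = 0
    · simp [hx]
    · simp [hroots x hx]
  have hpoly := (mul_eq_zero.1 hzero).resolve_left X_ne_zero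
  refine h ⟨?_, ?_, ?_⟩
  · simpa using congrArg (coeff · 0) hpoly
  · simpa using congrArg (coeff · 1) hpoly
  · simpa using congrArg (coeff · 2) hpoly

theorem exists_mul_add_mul_eq_and_mul_add_mul_eq {K : Type*} [Field K] {a b c d : K}
    (h : a * d - b * c ≠ 0) (p q : K) : ∃ x y, a * x + b * y = p ∧ c * x + d * y = q := by
  refine ⟨(p * d - b * q) * (a * d - b * c)⁻¹, (a * q - p * c) * (a * d - b * c)⁻¹, ?_, ?_⟩
  · linear_combination p * mul_inv_cancel₀ h
  · linear_combination q * mul_inv_cancel₀ h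

theorem exists_mul_add_mul_eq {K : Type*} [Field K] {a b : K} (h : ¬ (a = 0 ∧ b = 0)) (p : K) :
    ∃ x y, a * x + b * y = p := by
  by_cases ha : a = 0
  · exact ⟨0, p / b, by rw [mul_zero, zero_add, mul_div_cancel₀ _ fun hb => h ⟨ha, hb⟩]⟩
  · exact ⟨p / a, 0, by rw [mul_zero, add_zero, mul_div_cancel₀ _ ha]⟩

/-- The determinant of the `2 × 2` Toeplitz matrix `!![x 1, x 2; x 0, x 1]`, which occurs when a
row of a `3 × 3` matrix is to be completed to a Toeplitz matrix. -/
def toepDet {R : Type*} [CommRing R] (x : Fin 3 → R) : R := x 1 ^ 2 - x 0 * x 2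

/-- The third factor completes row `1` of `W` to a Toeplitz matrix with that row on top;
`h₁` and `h₂` say that row `1` of that matrix can be `W 2 - r • W 1`. Row `0` of `W` is reached by a
linear system of determinant `toepDet (W 1)`. -/
theorem hasToeplitzDecomposition_three_of_shift {W : Matrix (Fin 3) (Fin 3) ℂ} {r : ℂ}
    (h₁ : W 2 1 = r * W 1 1 + W 1 0) (h₂ : W 2 2 = r * W 1 2 + W 1 1) (hW : toepDet (W 1) ≠ 0) :
    HasToeplitzDecomposition W 3 := by
  obtain ⟨v, u, h01, h02⟩ := exists_mul_add_mul_eq_and_mul_add_mul_eq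
    (a := W 1 1) (b := W 1 0) (c := W 1 2) (d := W 1 1) (sq (W 1 1) ▸ hW)
    (W 0 1 - (W 2 0 - r * W 1 0)) (W 0 2 - W 1 0)
  have hleft : toep 1 0 0 1 (r - u) * toep 0 0 1 u v = !![v, u, 1; 1, 0, 0; r, 1, 0] := by
    ext i j
    fin_cases i <;> fin_cases j <;> simp [toep, mul_apply, Fin.sum_univ_three]
  have hprod : toep 1 0 0 1 (r - u) * toep 0 0 1 u v *
      toep (W 1 2) (W 1 1) (W 1 0) (W 2 0 - r * W 1 0)
        (W 0 0 - v * W 1 0 - u * (W 2 0 - r * W 1 0)) = W := by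
    rw [hleft]
    ext i j
    fin_cases i <;> fin_cases j <;>
      simp only [toep, mul_apply, Fin.sum_univ_three, of_apply, cons_val, Fin.zero_eta, Fin.mk_one,
        Fin.reduceFinMk]
    any_goals ring1
    · linear_combination h01
    · linear_combination h02
    · linear_combination -h₁
    · linear_combination -h₂
  rw [← hprod]
  exact (isToeplitz_toep _ _ _ _ _).hasToeplitzDecomposition_mul_mul (isToeplitz_toep _ _ _ _ _)
    (isToeplitz_toep _ _ _ _ _)

/-- The quadratic form `toepDet` is nondegenerate in three variables, so it has no totally isotropic
plane. -/
theorem crossProduct_eq_zero_of_toepDet_eq_zero {R : Type*} [CommRing R] [IsReduced R]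
    {x y : Fin 3 → R} (hx : toepDet x = 0) (hy : toepDet y = 0)
    (hxy : 2 * x 1 * y 1 - x 0 * y 2 - x 2 * y 0 = 0) : x ⨯₃ y = 0 := by
  rw [toepDet] at hx hy
  have h₀ : x 1 * y 2 - x 2 * y 1 = 0 := (pow_eq_zero_iff two_ne_zero).1 <| by
    linear_combination y 2 ^ 2 * hx + x 2 ^ 2 * hy - x 2 * y 2 * hxy
  have h₁ : x 2 * y 0 - x 0 * y 2 = 0 := (pow_eq_zero_iff two_ne_zero).1 <| by
    linear_combination 4 * y 1 ^ 2 * hx + 4 * x 0 * x 2 * hy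
      - (x 0 * y 2 + x 2 * y 0 + 2 * x 1 * y 1) * hxy
  have h₂ : x 0 * y 1 - x 1 * y 0 = 0 := (pow_eq_zero_iff two_ne_zero).1 <| by
    linear_combination y 0 ^ 2 * hx + x 0 ^ 2 * hy - x 0 * y 0 * hxy
  rw [cross_apply, h₀, h₁, h₂]
  simp

theorem exists_ne_zero_toepDet_add_smul_ne_zero {R : Type*} [CommRing R] [IsDomain R] [Infinite R]
    {x y : Fin 3 → R} (hxy : x ⨯₃ y ≠ 0) : ∃ α : R, α ≠ 0 ∧ toepDet (y + α • x) ≠ 0 := by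
  obtain ⟨α, hα, h⟩ := exists_ne_zero_add_mul_add_mul_sq_ne_zero
    fun h => hxy (crossProduct_eq_zero_of_toepDet_eq_zero h.2.2 h.1 h.2.1)
  refine ⟨α, hα, fun h' => h ?_⟩
  simp only [toepDet, Pi.add_apply, Pi.smul_apply, smul_eq_mul] at h' ⊢
  linear_combination h'

section Invertible

variable {M : Matrix (Fin 3) (Fin 3) ℂ} {x : Fin 3 → ℂ} {α : ℂ}

theorem exists_eq_toep_mul {a e : ℂ} (hx : x = M 1 + α • M 0)
    (hρ : 1 - a * α ^ 2 ≠ 0) (hκ : 1 - a * e ≠ 0) :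
    ∃ W : Matrix (Fin 3) (Fin 3) ℂ, M = toep a (-(a * α)) 1 (-α) e * W ∧
      W 1 = (1 - a * α ^ 2)⁻¹ • x ∧ W 2 = (1 - a * e)⁻¹ • (M 2 - e • M 0) + α • W 1 := by
  set w₁ := (1 - a * α ^ 2)⁻¹ • x with hw₁
  set w₂ := (1 - a * e)⁻¹ • (M 2 - e • M 0) + α • w₁ with hw₂
  have hw₁' : (1 - a * α ^ 2) • w₁ = M 1 + α • M 0 := by rw [hw₁, smul_inv_smul₀ hρ, hx]
  have hw₂' : (1 - a * e) • (w₂ - α • w₁) = M 2 - e • M 0 := by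
    rw [hw₂, add_sub_cancel_right, smul_inv_smul₀ hκ]
  refine ⟨of ![M 0 + (a * α) • w₁ - a • w₂, w₁, w₂], ?_, rfl, rfl⟩
  ext i j
  have hw₁j := congrFun hw₁' j
  have hw₂j := congrFun hw₂' j
  simp only [Pi.smul_apply, Pi.add_apply, Pi.sub_apply, smul_eq_mul] at hw₁j hw₂j
  fin_cases i <;>
    simp only [toep, mul_apply, Fin.sum_univ_three, of_apply, cons_val, Fin.zero_eta, Fin.mk_one,
      Fin.reduceFinMk, Pi.smul_apply, Pi.add_apply, Pi.sub_apply, smul_eq_mul]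
  · ring
  · linear_combination -hw₁j
  · linear_combination -hw₂j

theorem hasToeplitzDecomposition_four_of_shift {a e s : ℂ} (hx : x = M 1 + α • M 0)
    (hρ : 1 - a * α ^ 2 ≠ 0) (hκ : 1 - a * e ≠ 0) (hdet : toepDet x ≠ 0)
    (h₁ : (1 - a * α ^ 2) * (M 2 1 - e * M 0 1) = (1 - a * e) * x 0 + s * x 1)
    (h₂ : (1 - a * α ^ 2) * (M 2 2 - e * M 0 2) = (1 - a * e) * x 1 + s * x 2) :
    HasToeplitzDecomposition M 4 := by
  obtain ⟨W, hM, hW₁, hW₂⟩ := exists_eq_toep_mul hx hρ hκ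
  rw [hM]
  refine (hasToeplitzDecomposition_three_of_shift (r := s / (1 - a * e) + α) ?_ ?_ ?_).mul_left
    (isToeplitz_toep _ _ _ _ _)
  · simp only [hW₂, hW₁, Pi.smul_apply, Pi.add_apply, Pi.sub_apply, smul_eq_mul]
    field_simp
    linear_combination h₁
  · simp only [hW₂, hW₁, Pi.smul_apply, Pi.add_apply, Pi.sub_apply, smul_eq_mul]
    field_simp
    linear_combination h₂
  · have hscale : toepDet (W 1) = ((1 - a * α ^ 2)⁻¹) ^ 2 * toepDet x := by
      simp only [hW₁, toepDet, Pi.smul_apply, smul_eq_mul]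
      ring
    exact hscale ▸ mul_ne_zero (pow_ne_zero 2 (inv_ne_zero hρ)) hdet

theorem hasToeplitzDecomposition_four_of_row_zero_minor_ne_zero
    (hx : x = M 1 + α • M 0) (hdet : toepDet x ≠ 0)
    (h : M 0 1 * x 2 - x 1 * M 0 2 ≠ 0) : HasToeplitzDecomposition M 4 := by
  obtain ⟨e, s, h₁, h₂⟩ := exists_mul_add_mul_eq_and_mul_add_mul_eq h (M 2 1 - x 0) (M 2 2 - x 1)
  refine hasToeplitzDecomposition_four_of_shift (a := 0) (e := e) (s := s) hx (by simp) (by simp)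
    hdet ?_ ?_
  · linear_combination -h₁
  · linear_combination -h₂

theorem hasToeplitzDecomposition_four_of_row_two_minor_ne_zero (hα : α ≠ 0) (hx : x = M 1 + α • M 0)
    (hdet : toepDet x ≠ 0) (h : M 2 1 * x 2 - x 1 * M 2 2 ≠ 0) :
    HasToeplitzDecomposition M 4 := by
  obtain ⟨ρ, s, h₁, h₂⟩ := exists_mul_add_mul_eq_and_mul_add_mul_eq h (x 0) (x 1)
  have hρ : ρ ≠ 0 := by
    rintro rfl
    refine hdet ?_
    rw [toepDet]
    linear_combination x 2 * h₁ - x 1 * h₂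
  have ha : 1 - (1 - ρ) / α ^ 2 * α ^ 2 = ρ := by
    rw [div_mul_cancel₀ _ (pow_ne_zero 2 hα), sub_sub_cancel]
  refine hasToeplitzDecomposition_four_of_shift (a := (1 - ρ) / α ^ 2) (e := 0) (s := -s) hx
    (ha.symm ▸ hρ) (by simp) hdet ?_ ?_
  · rw [ha]
    linear_combination h₁
  · rw [ha]
    linear_combination h₂

theorem hasToeplitzDecomposition_four_of_det_ne_zero (hM : M.det ≠ 0) :
    HasToeplitzDecomposition M 4 := by
  have hcross : M 0 ⨯₃ M 1 ≠ 0 := fun h => hM <| by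
    have htriple : M.det = M 2 ⬝ᵥ M 0 ⨯₃ M 1 := by
      rw [det_fin_three, cross_apply, vec3_dotProduct]
      simp only [cons_val]
      ring
    rw [htriple, h, dotProduct_zero]
  obtain ⟨α, hα, hdet⟩ := exists_ne_zero_toepDet_add_smul_ne_zero hcross
  set x := M 1 + α • M 0 with hx
  by_cases h₀ : M 0 1 * x 2 - x 1 * M 0 2 = 0
  · refine hasToeplitzDecomposition_four_of_row_two_minor_ne_zero hα hx hdet fun h₂ => hM ?_
    have hM₁ (j) : M 1 j = x j - α * M 0 j := by simp [hx]
    refine (mul_eq_zero.1 (?_ : toepDet x * M.det = 0)).resolve_left hdet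
    rw [det_fin_three, toepDet, hM₁, hM₁, hM₁]
    linear_combination
      ((x 1 ^ 2 - x 0 * x 2) * M 2 0 - x 0 * x 1 * M 2 1 + x 0 ^ 2 * M 2 2) * h₀
        + (x 0 * x 1 * M 0 1 - x 0 ^ 2 * M 0 2 - (x 1 ^ 2 - x 0 * x 2) * M 0 0) * h₂
  · exact hasToeplitzDecomposition_four_of_row_zero_minor_ne_zero hx hdet h₀

end Invertible

section Singular

/-- The `f`-circulant matrix `x + y Z + z Z ^ 2`, where `Z` is the companion matrix of `X ^ 3 - f`.
These matrices form a commutative algebra of Toeplitz matrices, so that the inverse of an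
`f`-circulant matrix is Toeplitz. -/
def fCirculant {R : Type*} [CommRing R] (f x y z : R) : Matrix (Fin 3) (Fin 3) R :=
  toep (f * y) (f * z) x y z

/-- The scalar is the norm of `x + y Z + z Z ^ 2` over `R`. -/
theorem fCirculant_mul_fCirculant {R : Type*} [CommRing R] (f x y z : R) :
    fCirculant f (x ^ 2 - f * y * z) (f * z ^ 2 - x * y) (y ^ 2 - x * z) * fCirculant f x y z =
      (x ^ 3 + f * y ^ 3 + f ^ 2 * z ^ 3 - 3 * f * x * y * z) • 1 := by
  ext i j
  fin_cases i <;> fin_cases j <;>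
    simp [fCirculant, toep, mul_apply, Fin.sum_univ_three] <;> ring

theorem exists_isToeplitz_mul_fCirculant_eq_one {f x y z : ℂ}
    (h : x ^ 3 + f * y ^ 3 + f ^ 2 * z ^ 3 - 3 * f * x * y * z ≠ 0) :
    ∃ S : Matrix (Fin 3) (Fin 3) ℂ, IsToeplitz S ∧ S * fCirculant f x y z = 1 := by
  refine ⟨(x ^ 3 + f * y ^ 3 + f ^ 2 * z ^ 3 - 3 * f * x * y * z)⁻¹ •
    fCirculant f (x ^ 2 - f * y * z) (f * z ^ 2 - x * y) (y ^ 2 - x * z),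
    (isToeplitz_toep _ _ _ _ _).smul _, ?_⟩
  rw [Matrix.smul_mul, fCirculant_mul_fCirculant, inv_smul_smul₀ h]

theorem exists_isToeplitz_mul_eq_one_row_one_eq {v : Fin 3 → ℂ} (hv : v ≠ 0) :
    ∃ S T : Matrix (Fin 3) (Fin 3) ℂ, IsToeplitz S ∧ S * T = 1 ∧ T 1 = v := by
  obtain ⟨f, hf, h⟩ := exists_ne_zero_add_mul_add_mul_sq_ne_zero (a := v 2 ^ 3)
    (b := v 1 ^ 3 - 3 * v 0 * v 1 * v 2) (c := v 0 ^ 3) <| by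
      rintro ⟨h₂, h₁, h₀⟩
      have h₀ : v 0 = 0 := pow_eq_zero_iff three_ne_zero |>.1 h₀
      have h₂ : v 2 = 0 := pow_eq_zero_iff three_ne_zero |>.1 h₂
      have h₁ : v 1 = 0 := by simpa [h₀] using h₁
      exact hv (by ext i; fin_cases i <;> assumption)
  obtain ⟨S, hS, hST⟩ := exists_isToeplitz_mul_fCirculant_eq_one
    (f := f) (x := v 1) (y := v 0) (z := v 2 / f) <| by
      convert div_ne_zero h hf using 1
      field_simp
      ring
  refine ⟨S, _, hS, hST, ?_⟩
  ext j
  fin_cases j <;> simp [fCirculant, toep, mul_div_cancel₀ _ hf]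

variable {M N : Matrix (Fin 3) (Fin 3) ℂ}

/-- `toep 1 0 0 0 1` swaps rows `0` and `2` and kills row `1`, and rows `x`, `y` are the first and
last row of a Toeplitz matrix as soon as `x 0 = y 2`. -/
theorem hasToeplitzDecomposition_three_of_corner_eq {U V : Matrix (Fin 3) (Fin 3) ℂ}
    (hN : N 1 = 0) (hV : IsToeplitz V) (hUV : U * V = 1) (h : (N * U) 2 0 = (N * U) 0 2) :
    HasToeplitzDecomposition N 3 := by
  have hrow (j) : (N * U) 1 j = 0 := by simp [mul_apply, hN]
  have hprod : toep 1 0 0 0 1 * toep ((N * U) 2 2) ((N * U) 2 1) ((N * U) 2 0) ((N * U) 0 1)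
      ((N * U) 0 0) = N * U := by
    generalize N * U = P at h hrow
    ext i j
    fin_cases i <;> fin_cases j <;> simp [toep, mul_apply, Fin.sum_univ_three, hrow, h]
  rw [← mul_one N, ← hUV, ← Matrix.mul_assoc, ← hprod]
  exact (isToeplitz_toep _ _ _ _ _).hasToeplitzDecomposition_mul_mul (isToeplitz_toep _ _ _ _ _) hV

theorem hasToeplitzDecomposition_three_of_row_one_eq_zero (hN : N 1 = 0) :
    HasToeplitzDecomposition N 3 := by
  have hinv (u v : ℂ) := exists_isToeplitz_mul_fCirculant_eq_one (f := 0) (x := 1) (y := u) (z := v)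
    (by simp)
  by_cases hp : N 0 0 = 0 ∧ N 0 1 = 0
  · by_cases hq : N 2 1 = 0 ∧ N 2 2 = 0
    · refine (hasToeplitzDecomposition_one_iff.2 ?_).mono (by norm_num : 1 ≤ 3)
      have hN' : N = toep (N 0 2) 0 0 0 (N 2 0) := by
        ext i j
        fin_cases i <;> fin_cases j <;> simp [toep, hN, hp, hq]
      exact hN' ▸ isToeplitz_toep _ _ _ _ _
    · obtain ⟨u, v, huv⟩ : ∃ u v, N 2 1 * u + N 2 2 * v = N 0 2 - N 2 0 :=
        exists_mul_add_mul_eq hq _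
      obtain ⟨V, hV, hVU⟩ := hinv u v
      refine hasToeplitzDecomposition_three_of_corner_eq hN hV (mul_eq_one_comm.1 hVU) ?_
      simp only [fCirculant, toep, mul_apply, Fin.sum_univ_three, of_apply, cons_val]
      linear_combination huv
  · obtain ⟨u, v, huv⟩ : ∃ u v, N 0 1 * u + N 0 0 * v = N 2 0 - N 0 2 :=
      exists_mul_add_mul_eq (by tauto) _
    obtain ⟨V, hV, hVU⟩ := hinv u v
    refine hasToeplitzDecomposition_three_of_corner_eq hN hV.transpose (U := (fCirculant 0 1 u v)ᵀ)
      (by rw [← transpose_mul, hVU, transpose_one]) ?_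
    simp only [fCirculant, toep, transpose_apply, mul_apply, Fin.sum_univ_three, of_apply, cons_val]
    linear_combination -huv

theorem hasToeplitzDecomposition_four_of_det_eq_zero (hM : M.det = 0) :
    HasToeplitzDecomposition M 4 := by
  obtain ⟨v, hv, hvM⟩ := exists_vecMul_eq_zero_iff.2 hM
  obtain ⟨S, T, hS, hST, hT⟩ := exists_isToeplitz_mul_eq_one_row_one_eq hv
  have hTM : (T * M) 1 = 0 := by rw [mul_apply_eq_vecMul, hT, hvM]
  have hM' := (hasToeplitzDecomposition_three_of_row_one_eq_zero hTM).mul_left hS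
  rwa [← Matrix.mul_assoc, hST, Matrix.one_mul] at hM'

end Singular

theorem toeplitzNumber_le_four (M : Matrix (Fin 3) (Fin 3) ℂ) : toeplitzNumber M ≤ 4 :=
  (toeplitzNumber_le_iff (s := 4) (by norm_num)).2 <| by
    by_cases hM : M.det = 0
    · exact hasToeplitzDecomposition_four_of_det_eq_zero hM
    · exact hasToeplitzDecomposition_four_of_det_ne_zero hM

theorem mainTheorem2 :
    (3 ≤ maxToeplitzNumber 3 ∧ maxToeplitzNumber 3 ≤ 4) ∧
    toeplitzNumber (Matrix.diagonal ![(1 : ℂ), 2, 3]) = 3 ∧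
    (∀ M : Matrix (Fin 3) (Fin 3) ℂ, M.rank = 1 → toeplitzNumber M ≤ 3) ∧
    (∀ M : Matrix (Fin 3) (Fin 3) ℂ, M.rank = 2 → toeplitzNumber M ≤ 4) ∧
    (∀ M : Matrix (Fin 3) (Fin 3) ℂ, IsUnit M → toeplitzNumber M ≤ 4) := by
  have hdiag : 3 ≤ toeplitzNumber (diagonal ![(1 : ℂ), 2, 3]) := by
    refine three_le_toeplitzNumber_diagonal (i := 1) ?_ (by decide) (by decide) (by simp)
    intro i j h
    fin_cases i <;> fin_cases j <;> simp_all
  exact ⟨⟨hdiag.trans (le_iSup toeplitzNumber _), iSup_le toeplitzNumber_le_four⟩,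
    toeplitzNumber_diagonal_le_three.antisymm hdiag,
    fun _ => toeplitzNumber_le_three_of_rank_eq_one,
    fun M _ => toeplitzNumber_le_four M,
    fun M _ => toeplitzNumber_le_four M⟩
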